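/- Let $n \ge 0$. States of $n$ qubits are nonzero vectors $\psi \in (\mathbb{C}^2)^{\otimes n}$, written in the computational basis as $\psi = (\psi_{\mathbf x})_{\mathbf x \in \mathbb{Z}_2^n}$ and considered without normalisation (that is, up to nonzero complex factors). *Stabilizer states.* Let $\mathbf{P}_1$ be the group of $2\times 2$ matrices generated by $X = \begin{pmatrix}0&1\\1&0\end{pmatrix}$, $Z = \begin{pmatrix}1&0\\0&-1\end{pmatrix}$ and the scalar $i$, and let $\mathbf{P}_n$ be the group of all $n$-fold tensor products of elements of $\mathbf{P}_1$. A state $\psi$ is a *stabilizer state* if there is a commutative subgroup $S \le \mathbf{P}_n$ of order $2^n$ with $-I \notin S$ such that $g\psi = \psi$ for all $g \in S$. *Generalised two-graph states.* Let $G$ be a graph with vertex set $\mathcal V = \{0,\dots,n-1\}$, possibly with loops, with binary adjacency matrix $\Gamma_G$. Let $\mathcal V = \mathcal L \sqcup \mathcal R$ be a partition (either part may be empty) such that $G$ has no edges between distinct vertices of $\mathcal L$, and let $\mathcal Q \subseteq \mathcal R$, with $\mathcal Q_j = 1$ if $j \in \mathcal Q$ and $\mathcal Q_j = 0$ otherwise.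 Let $P$ be the subgraph of $G$ induced on $\mathcal R$ and let $M = G - P$ (difference of adjacency matrices). Define $m : \mathbb{Z}_2^n \to \mathbb{Z}_2$ and $p : \mathbb{Z}_2^n \to \mathbb{Z}_4$ by $$ m(\mathbf x) = \prod_{i \in \mathcal L} \Bigl(\Gamma_{M_{ii}} + 1 + x_i + \sum_{j \in \mathcal R} \Gamma_{M_{ij}} x_j\Bigr), \qquad p(\mathbf x) = \sum_{i,j \in \mathcal R,\ i<j} 2\,\Gamma_{P_{ij}} x_i x_j + \sum_{j \in \mathcal R} (2\,\Gamma_{P_{jj}} + \mathcal Q_j)\, x_j, $$ where $m = 1$ if $\mathcal L = \emptyset$, and in $p$ the bits are read as $0, 1 \in \mathbb{Z}_4$. A state $\psi$ is a *generalised two-graph state* if, for some such $(G, \mathcal R, \mathcal Q)$ and some $c \in \mathbb{C}\setminus\{0\}$, one has $\psi_{\mathbf x} = c\, m(\mathbf x)\, i^{p(\mathbf x)}$ for all $\mathbf x$, where the values of $m$ are read as the complex numbers $0, 1$. A *two-graph state* is a state of the form $\psi_{\mathbf x} = c\, m(\mathbf x)(-1)^{p'(\mathbf x)}$ with $c \neq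 0$, $m$ as above and $p'(\mathbf x) = \sum_{i,j\in\mathcal R,\ i<j} \Gamma_{P_{ij}} x_i x_j + \sum_{j \in \mathcal R} \Gamma_{P_{jj}} x_j \in \mathbb{Z}_2$. **Corollary.** A vector is a generalised two-graph state if and only if it is a stabilizer state. In particular, every two-graph state is a generalised two-graph state, and hence a stabilizer state. -/

import Mathlib

open scoped Matrix

noncomputable section

namespace TwoGraphState

/-! ### Qubits, tensor products of matrices, and the Pauli group -/

/-- Labels of the computational basis of `n` qubits: binary strings of length `n`. -/
abbrev Bits (n : ℕ) : Type := Fin n → ZMod 2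

/-- State vectors of `n` qubits, written in the computational basis. -/
abbrev StateVec (n : ℕ) : Type := Bits n → ℂ

/-- Single-qubit operators. -/
abbrev Op1 : Type := Matrix (ZMod 2) (ZMod 2) ℂ

/-- Operators on `n` qubits. -/
abbrev Op (n : ℕ) : Type := Matrix (Bits n) (Bits n) ℂ

/-- The tensor product `A 0 ⊗ A 1 ⊗ ⋯ ⊗ A (n-1)`. -/
def tensor {n : ℕ} (A : Fin n → Op1) : Op n :=
  Matrix.of fun x y => ∏ v, A v (x v) (y v)

theorem tensor_one {n : ℕ} : tensor (fun _ : Fin n => (1 : Op1)) = 1 := by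
  ext x y
  by_cases h : x = y
  · subst h
    simp [tensor]
  · obtain ⟨v, hv⟩ := Function.ne_iff.mp h
    rw [Matrix.one_apply_ne h]
    exact Finset.prod_eq_zero (Finset.mem_univ v) (Matrix.one_apply_ne hv)

theorem tensor_mul {n : ℕ} (A B : Fin n → Op1) :
    tensor (fun v => A v * B v) = tensor A * tensor B := by
  ext x y
  simp only [tensor, Matrix.of_apply, Matrix.mul_apply, ← Finset.prod_mul_distrib]
  rw [Finset.prod_univ_sum, Fintype.piFinset_univ]

/-- The tensor product of invertible single-qubit operators, as a group homomorphism. -/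
def tensorHom (n : ℕ) : (Fin n → Op1ˣ) →* (Op n)ˣ where
  toFun U :=
    { val := tensor fun v => (U v : Op1)
      inv := tensor fun v => ((U v)⁻¹ : Op1ˣ)
      val_inv := by rw [← tensor_mul]; simp [tensor_one]
      inv_val := by rw [← tensor_mul]; simp [tensor_one] }
  map_one' := Units.ext (by simp [tensor_one])
  map_mul' U V := Units.ext (by simp [tensor_mul])

/-- The Pauli matrix `X`, with rows `(0, 1)` and `(1, 0)`. -/
def matX : Op1 := Matrix.of fun a b => if a = b then 0 else 1

/-- The Pauli matrix `Z = diag (1, -1)`. -/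
def matZ : Op1 := Matrix.diagonal fun a => if a = 0 then 1 else -1

theorem matX_mul_self : matX * matX = 1 := by
  ext a b
  simp only [matX, Matrix.mul_apply, Matrix.of_apply, Matrix.one_apply]
  fin_cases a <;> fin_cases b <;> simp [Fin.sum_univ_two, ZMod]

theorem matZ_mul_self : matZ * matZ = 1 := by
  rw [matZ, Matrix.diagonal_mul_diagonal, ← Matrix.diagonal_one]
  congr 1
  funext a
  split_ifs <;> simp

/-- `X` as an invertible matrix. -/
def unitX : Op1ˣ := ⟨matX, matX, matX_mul_self, matX_mul_self⟩

/-- `Z` as an invertible matrix. -/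
def unitZ : Op1ˣ := ⟨matZ, matZ, matZ_mul_self, matZ_mul_self⟩

/-- The scalar matrix `i` as an invertible matrix. -/
def unitI : Op1ˣ :=
  ⟨Complex.I • 1, (-Complex.I) • 1, by simp [smul_smul], by simp [smul_smul]⟩

/-- The single-qubit Pauli group, generated by `X`, `Z` and `i`. -/
def pauliGroup1 : Subgroup Op1ˣ := Subgroup.closure {unitX, unitZ, unitI}

/-- The `n`-qubit Pauli group: all `n`-fold tensor products of single-qubit Pauli matrices. -/
def pauliGroup (n : ℕ) : Subgroup (Op n)ˣ :=
  (Subgroup.pi Set.univ fun _ : Fin n => pauliGroup1).map (tensorHom n)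

/-! ### Stabilizer states -/

/-- The subgroups of the Pauli group which stabilize a single state: commutative, not containing
`-1`, and of order `2 ^ n` (equivalently, generated by `n` independent commuting Paulis). -/
structure IsMaximalStabilizer {n : ℕ} (S : Subgroup (Op n)ˣ) : Prop where
  le_pauliGroup : S ≤ pauliGroup n
  comm : ∀ g ∈ S, ∀ h ∈ S, g * h = h * g
  neg_one_notMem : (-1 : (Op n)ˣ) ∉ S
  card_eq : Nat.card S = 2 ^ n

/-- A stabilizer state: a (nonzero) vector fixed by all the elements of such a subgroup. No
normalisation is imposed: states are taken up to a nonzero complex factor. -/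
def IsStabilizerState {n : ℕ} (ψ : StateVec n) : Prop :=
  ψ ≠ 0 ∧ ∃ S : Subgroup (Op n)ˣ, IsMaximalStabilizer S ∧ ∀ g ∈ S, (g : Op n) *ᵥ ψ = ψ

/-! ### Two-graph states -/

/-- A pair `(G, R)`: a graph `G` on the vertices `0, …, n-1`, with possible loops, given by its
symmetric binary adjacency matrix, and a set `R` of vertices, such that the only edges of `G`
between vertices of `L = Rᶜ` are loops. -/
structure GraphSet (n : ℕ) where
  /-- The adjacency matrix of `G`. -/
  adj : Matrix (Fin n) (Fin n) (ZMod 2)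
  symm : adj.IsSymm
  /-- The set `R`. -/
  R : Finset (Fin n)
  adj_left : ∀ i ∉ R, ∀ j ∉ R, i ≠ j → adj i j = 0

namespace GraphSet

variable {n : ℕ}

/-- The adjacency matrix of the phase graph `P`, the subgraph of `G` induced on `R`. -/
def phaseAdj (D : GraphSet n) : Matrix (Fin n) (Fin n) (ZMod 2) :=
  Matrix.of fun i j => if i ∈ D.R ∧ j ∈ D.R then D.adj i j else 0

/-- The adjacency matrix of the magnitude graph `M = G - P`. -/
def magAdj (D : GraphSet n) : Matrix (Fin n) (Fin n) (ZMod 2) :=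
  D.adj - D.phaseAdj

/-- The magnitude function `m`, a product of affine functions, one for each vertex of `L = Rᶜ`. -/
def mag (D : GraphSet n) (x : Bits n) : ZMod 2 :=
  ∏ i ∈ D.Rᶜ, (D.magAdj i i + 1 + x i + ∑ j ∈ D.R, D.magAdj i j * x j)

/-- The Boolean quadratic phase function `p` of the two-graph state of `(G, R)`. -/
def phase (D : GraphSet n) (x : Bits n) : ZMod 2 :=
  (∑ i ∈ D.R, ∑ j ∈ D.R with i < j, D.phaseAdj i j * x i * x j) +
    ∑ j ∈ D.R, D.phaseAdj j j * x j

end GraphSet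

/-- A triple `(G, R, Q)`: a pair `(G, R)` as above together with a subset `Q` of `R`. -/
structure GenGraphSet (n : ℕ) extends GraphSet n where
  /-- The set `Q`. -/
  Q : Finset (Fin n)
  Q_subset : Q ⊆ R

/-- The embedding of `{0, 1} = ℤ/2` into `ℤ/4`. -/
def lift4 (a : ZMod 2) : ZMod 4 := (a.val : ZMod 4)

/-- The generalised quadratic phase function `p`, with values in `ℤ/4`, of `(G, R, Q)`. -/
def GenGraphSet.genPhase {n : ℕ} (D : GenGraphSet n) (x : Bits n) : ZMod 4 :=
  (∑ i ∈ D.R, ∑ j ∈ D.R with i < j,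
      2 * lift4 (D.phaseAdj i j) * lift4 (x i) * lift4 (x j)) +
    ∑ j ∈ D.R, (2 * lift4 (D.phaseAdj j j) + if j ∈ D.Q then 1 else 0) * lift4 (x j)

/-- `ψ` is the two-graph state `c m (-1) ^ p` of some `(G, R)`. -/
def IsTwoGraphState {n : ℕ} (ψ : StateVec n) : Prop :=
  ∃ (D : GraphSet n) (c : ℂ), c ≠ 0 ∧
    ∀ x, ψ x = c * ((D.mag x).val : ℂ) * (-1 : ℂ) ^ (D.phase x).val

/-- `ψ` is the generalised two-graph state `c m i ^ p` of some `(G, R, Q)`. -/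
def IsGenTwoGraphState {n : ℕ} (ψ : StateVec n) : Prop :=
  ∃ (D : GenGraphSet n) (c : ℂ), c ≠ 0 ∧
    ∀ x, ψ x = c * ((D.mag x).val : ℂ) * Complex.I ^ (D.genPhase x).val

end TwoGraphState

end

/-!
Both classes of states are the vectors whose support is a coset `x₀ + A` of a subspace `A` of
`(ℤ/2)ⁿ` and which, along that coset, are the exponential of a `ℤ/4`-valued quadratic function. The
predicate `IsQuadraticOn` expresses this through Pauli operators: differences of points of the
support lie in `A`, and for each `a ∈ A` some operator `i ^ k X ^ a Z ^ φ` fixes the vector.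

Let `S` be a group of Pauli operators fixing `ψ ≠ 0`. As `ψ` determines the phase `k` from the label
`(a, φ)`, the order of `S` is the number of its labels, which is `|A| |B|` for `A` the set of shifts
`a` occurring in `S` and `B` the set of functionals `φ` of its diagonal elements
(`card_eq_two_pow`). A diagonal element of `S` is constant on the support of `ψ`, and the support is
invariant under `A`, so that `B` lies in the annihilator of `A`. Hence `|S| = 2 ^ n` forces `B` to
be the whole annihilator, and this confines the support to one coset of `A`
(`isQuadraticOn_of_card`). Conversely, if `ψ` is quadratic on a coset of `A`, the group of all Pauli
operators fixing it has exactly the shifts `A` and the diagonal labels in the annihilator of `A`, so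
its order is `2 ^ n` (`IsQuadraticOn.card_eq`).

For a generalised two-graph state, `A` is the homogeneous solution space of the magnitude equations,
and the required operators come from the polar form of the phase function
(`GenGraphSet.genPhase_add`). Conversely, `A` is the graph of a linear map on a suitable set `R` of
coordinates (`exists_information_set`); this map and the normalised base point of the support give
the edges from `Rᶜ` to `R` and the loops on `Rᶜ`, while the phases acquired by moving along the basis
vectors of `A`, one at a time and in increasing order, give the phase graph and the set `Q`
(`apply_add_sum`, `IsQuadraticOn.isGenTwoGraphState`).
-/

open scoped Matrix

noncomputable section

namespace TwoGraphState

/-! ### Fourth roots of unity -/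

/-- The character `k ↦ i ^ k` of `ℤ/4`. -/
def iPow : AddChar (ZMod 4) ℂ :=
  AddChar.zmodChar 4 Complex.I_pow_four

theorem iPow_apply (k : ZMod 4) : iPow k = Complex.I ^ k.val :=
  AddChar.zmodChar_apply _ k

theorem iPow_ne_zero (k : ZMod 4) : iPow k ≠ 0 := by
  rw [iPow_apply]
  exact pow_ne_zero _ Complex.I_ne_zero

theorem iPow_eq_one {k : ZMod 4} (h : iPow k = 1) : k = 0 := by
  rw [iPow_apply] at h
  have h3 : -Complex.I ≠ 1 := fun h => by simpa using congrArg Complex.re h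
  have h1 : Complex.I ≠ 1 := fun h => by simpa using congrArg Complex.re h
  have h2 : (-1 : ℂ) ≠ 1 := by norm_num
  have hk : k.val < 4 := k.val_lt
  rw [← ZMod.val_eq_zero]
  generalize k.val = m at h hk
  interval_cases m <;> simp_all [Complex.I_pow_three]

theorem iPow_injective : Function.Injective iPow := by
  intro k l h
  refine sub_eq_zero.mp (iPow_eq_one ?_)
  rw [AddChar.map_sub_eq_div, h, div_self (iPow_ne_zero l)]

/-- The embedding `z ↦ 2 z` of `ℤ/2` into `ℤ/4`; thus `iPow (double z) = (-1) ^ z`. -/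
def double : ZMod 2 →+ ZMod 4 where
  toFun z := 2 * lift4 z
  map_zero' := by decide
  map_add' := by decide

theorem double_eq_zero : ∀ {z : ZMod 2}, double z = 0 → z = 0 := by
  decide

theorem double_add_self : ∀ z : ZMod 2, double z + double z = 0 := by
  decide

theorem eq_zero_or_eq_one : ∀ z : ZMod 2, z = 0 ∨ z = 1 := by
  decide

/-! ### Pauli operators labelled by vectors and functionals -/

section Pauli

variable {G : Type*} [AddCommGroup G] [Module (ZMod 2) G] [DecidableEq G]

/-- The operator `i ^ k X ^ a Z ^ φ` on functions on a vector space `G` over `ℤ/2`: here `X ^ a` is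
the translation by `a`, and `Z ^ φ`, for a linear functional `φ`, is the diagonal operator
`(-1) ^ φ`. For `G = Bits n` these are the Pauli operators on `n` qubits. -/
def pauliOp (k : ZMod 4) (a : G) (φ : Module.Dual (ZMod 2) G) : Matrix G G ℂ :=
  Matrix.of fun x y => if y = x + a then iPow (k + double (φ y)) else 0

theorem pauliOp_apply (k : ZMod 4) (a : G) (φ : Module.Dual (ZMod 2) G) (x y : G) :
    pauliOp k a φ x y = if y = x + a then iPow (k + double (φ y)) else 0 :=
  rfl

theorem pauliOp_zero : pauliOp 0 (0 : G) 0 = 1 := by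
  ext x y
  simp [pauliOp_apply, Matrix.one_apply, eq_comm]

variable [Fintype G]

theorem pauliOp_mul (k l : ZMod 4) (a b : G) (φ χ : Module.Dual (ZMod 2) G) :
    pauliOp k a φ * pauliOp l b χ = pauliOp (k + l + double (φ b)) (a + b) (φ + χ) := by
  ext x y
  rw [Matrix.mul_apply, Finset.sum_eq_single (x + a)
    (fun z _ hz => by rw [pauliOp_apply, if_neg hz, zero_mul]) (by simp)]
  simp only [pauliOp_apply, if_true, mul_ite, mul_zero, add_assoc x]
  split_ifs with h
  · rw [← AddChar.map_add_eq_mul]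
    congr 1
    have : x + a = y + b := by rw [h, ← add_assoc, add_assoc (x + a), ZModModule.add_self, add_zero]
    rw [this]
    simp only [map_add, LinearMap.add_apply]
    abel
  · rfl

/-- `pauliOp k a φ` as an invertible operator. -/
def pauliUnit (k : ZMod 4) (a : G) (φ : Module.Dual (ZMod 2) G) : (Matrix G G ℂ)ˣ where
  val := pauliOp k a φ
  inv := pauliOp (-k + double (φ a)) a φ
  val_inv := by
    rw [pauliOp_mul, ZModModule.add_self, ZModModule.add_self, add_neg_cancel_left,
      double_add_self, pauliOp_zero]
  inv_val := by
    rw [pauliOp_mul, ZModModule.add_self, ZModModule.add_self,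
      show -k + double (φ a) + k + double (φ a) = double (φ a) + double (φ a) by abel,
      double_add_self, pauliOp_zero]

theorem pauliUnit_zero : pauliUnit 0 (0 : G) 0 = 1 :=
  Units.ext pauliOp_zero

theorem pauliUnit_mul (k l : ZMod 4) (a b : G) (φ χ : Module.Dual (ZMod 2) G) :
    pauliUnit k a φ * pauliUnit l b χ = pauliUnit (k + l + double (φ b)) (a + b) (φ + χ) :=
  Units.ext (pauliOp_mul k l a b φ χ)

theorem pauliUnit_inv (k : ZMod 4) (a : G) (φ : Module.Dual (ZMod 2) G) :
    (pauliUnit k a φ)⁻¹ = pauliUnit (-k + double (φ a)) a φ :=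
  Units.ext rfl

theorem pauliUnit_injective {k l : ZMod 4} {a b : G} {φ χ : Module.Dual (ZMod 2) G}
    (h : pauliUnit k a φ = pauliUnit l b χ) : k = l ∧ a = b ∧ φ = χ := by
  have key : ∀ x y, pauliOp k a φ x y = pauliOp l b χ x y := fun x y =>
    congrArg (fun U : (Matrix G G ℂ)ˣ => U.val x y) h
  have hab : a = b := by
    by_contra hab
    have := key 0 a
    simp [pauliOp_apply, hab, iPow_ne_zero] at this
  subst hab
  have hphase : ∀ y, k + double (φ y) = l + double (χ y) := fun y => by
    refine iPow_injective ?_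
    have h1 := key (y + a) y
    have h2 : y = y + a + a := by rw [add_assoc, ZModModule.add_self, add_zero]
    rwa [pauliOp_apply, pauliOp_apply, if_pos h2, if_pos h2] at h1
  have hkl : k = l := by simpa using hphase 0
  refine ⟨hkl, rfl, LinearMap.ext fun y => ?_⟩
  have h1 : double (φ y - χ y) = 0 := by
    rw [map_sub, sub_eq_zero]
    simpa [hkl] using hphase y
  exact sub_eq_zero.mp (double_eq_zero h1)

theorem pauliOp_mulVec (k : ZMod 4) (a : G) (φ : Module.Dual (ZMod 2) G) (ψ : G → ℂ) (x : G) :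
    (pauliOp k a φ *ᵥ ψ) x = iPow (k + double (φ (x + a))) * ψ (x + a) := by
  simp [Matrix.mulVec, dotProduct, pauliOp_apply]

/-- A vector is fixed by `i ^ k X ^ a Z ^ φ` exactly when its translate by `a` differs from it by
the phase `k + 2 φ`. -/
theorem pauliOp_mulVec_eq_self_iff {k : ZMod 4} {a : G} {φ : Module.Dual (ZMod 2) G} {ψ : G → ℂ} :
    pauliOp k a φ *ᵥ ψ = ψ ↔ ∀ x, ψ (x + a) = iPow (k + double (φ x)) * ψ x := by
  have hxa : ∀ x, x + a + a = x := fun x => by rw [add_assoc, ZModModule.add_self, add_zero]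
  constructor
  · intro h x
    have := congrFun h (x + a)
    rw [pauliOp_mulVec, hxa] at this
    exact this.symm
  · intro h
    ext x
    rw [pauliOp_mulVec, ← h, hxa]

theorem ne_zero_of_pauliOp_mulVec {k : ZMod 4} {a : G} {φ : Module.Dual (ZMod 2) G} {ψ : G → ℂ}
    (h : pauliOp k a φ *ᵥ ψ = ψ) {x : G} (hx : ψ x ≠ 0) : ψ (x + a) ≠ 0 := by
  rw [pauliOp_mulVec_eq_self_iff.mp h]
  exact mul_ne_zero (iPow_ne_zero _) hx

theorem phase_unique {k l : ZMod 4} {a : G} {φ : Module.Dual (ZMod 2) G} {ψ : G → ℂ} (hψ : ψ ≠ 0)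
    (hk : pauliOp k a φ *ᵥ ψ = ψ) (hl : pauliOp l a φ *ᵥ ψ = ψ) : k = l := by
  obtain ⟨x, hx⟩ := Function.ne_iff.mp hψ
  have h := (pauliOp_mulVec_eq_self_iff.mp hk x).symm.trans (pauliOp_mulVec_eq_self_iff.mp hl x)
  exact add_right_cancel (iPow_injective (mul_right_cancel₀ hx h))

/-! ### Groups of Pauli operators fixing a vector -/

/-- The labels `(a, φ)` of the operators `i ^ k X ^ a Z ^ φ` in a group `S`, the phase `k` being
forgotten. -/
def labels (S : Subgroup (Matrix G G ℂ)ˣ) : Submodule (ZMod 2) (G × Module.Dual (ZMod 2) G) :=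
  AddSubgroup.toZModSubmodule 2
    { carrier := {p | ∃ k, pauliUnit k p.1 p.2 ∈ S}
      zero_mem' := ⟨0, by rw [Prod.fst_zero, Prod.snd_zero, pauliUnit_zero]; exact S.one_mem⟩
      add_mem' := by
        rintro p q ⟨k, hk⟩ ⟨l, hl⟩
        exact ⟨k + l + double (p.2 q.1), by
          simpa only [pauliUnit_mul, Prod.fst_add, Prod.snd_add] using S.mul_mem hk hl⟩
      neg_mem' := by
        rintro p ⟨k, hk⟩
        exact ⟨k, by rwa [ZModModule.neg_eq_self]⟩ }

theorem mem_labels {S : Subgroup (Matrix G G ℂ)ˣ} {p : G × Module.Dual (ZMod 2) G} :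
    p ∈ labels S ↔ ∃ k, pauliUnit k p.1 p.2 ∈ S :=
  Iff.rfl

/-- The labels of the translations in `S`. -/
def shiftLabels (S : Subgroup (Matrix G G ℂ)ˣ) : Submodule (ZMod 2) G :=
  (labels S).map (LinearMap.fst _ _ _)

/-- The labels of the diagonal operators in `S`. -/
def diagLabels (S : Subgroup (Matrix G G ℂ)ˣ) : Submodule (ZMod 2) (Module.Dual (ZMod 2) G) :=
  (labels S).comap (LinearMap.inr _ _ _)

theorem mem_shiftLabels {S : Subgroup (Matrix G G ℂ)ˣ} {a : G} :
    a ∈ shiftLabels S ↔ ∃ k φ, pauliUnit k a φ ∈ S := by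
  simp only [shiftLabels, Submodule.mem_map, mem_labels]
  constructor
  · rintro ⟨p, ⟨k, hk⟩, rfl⟩
    exact ⟨k, p.2, hk⟩
  · rintro ⟨k, φ, h⟩
    exact ⟨(a, φ), ⟨k, h⟩, rfl⟩

theorem mem_diagLabels {S : Subgroup (Matrix G G ℂ)ˣ} {φ : Module.Dual (ZMod 2) G} :
    φ ∈ diagLabels S ↔ ∃ k, pauliUnit k 0 φ ∈ S :=
  Iff.rfl

theorem finrank_labels (S : Subgroup (Matrix G G ℂ)ˣ) :
    Module.finrank (ZMod 2) (shiftLabels S) + Module.finrank (ZMod 2) (diagLabels S) =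
      Module.finrank (ZMod 2) (labels S) := by
  have hker : (LinearMap.ker ((LinearMap.fst (ZMod 2) G (Module.Dual (ZMod 2) G)).domRestrict
      (labels S))).map (labels S).subtype = (diagLabels S).map (LinearMap.inr _ _ _) := by
    rw [diagLabels, Submodule.map_comap_eq, LinearMap.ker_domRestrict, Submodule.map_comap_subtype,
      LinearMap.range_inr, inf_comm]
  have h := LinearMap.finrank_range_add_finrank_ker (K := ZMod 2) (V := labels S)
    ((LinearMap.fst (ZMod 2) G (Module.Dual (ZMod 2) G)).domRestrict (labels S))
  rwa [LinearMap.range_domRestrict, ← Submodule.finrank_map_subtype_eq (labels S), hker,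
    ← (Submodule.equivMapOfInjective (LinearMap.inr (ZMod 2) G (Module.Dual (ZMod 2) G))
      LinearMap.inr_injective (diagLabels S)).finrank_eq] at h

/-- A group of Pauli operators fixing a nonzero vector has as many elements as labels, because the
vector determines the phase of an operator from its label. -/
theorem card_eq_two_pow {S : Subgroup (Matrix G G ℂ)ˣ} {ψ : G → ℂ} (hψ : ψ ≠ 0)
    (hS : ∀ g ∈ S, ∃ k a φ, g = pauliUnit k a φ) (hfix : ∀ g ∈ S, (g : Matrix G G ℂ) *ᵥ ψ = ψ) :
    Nat.card S = 2 ^ (Module.finrank (ZMod 2) (shiftLabels S) +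
      Module.finrank (ZMod 2) (diagLabels S)) := by
  have hcard : Nat.card S = Nat.card (labels S) := by
    choose k a φ h using hS
    refine Nat.card_congr (Equiv.ofBijective
      (fun g : S => (⟨(a g g.2, φ g g.2), k g g.2, ?_⟩ : labels S)) ⟨?_, ?_⟩)
    · simpa only [← h g g.2] using g.2
    · intro g g' hg
      obtain ⟨ha, hφ⟩ : a g g.2 = a g' g'.2 ∧ φ g g.2 = φ g' g'.2 :=
        Prod.mk.inj (congrArg Subtype.val hg)
      have h1 := hfix g g.2
      have h2 := hfix g' g'.2
      rw [h g g.2] at h1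
      rw [h g' g'.2, ← ha, ← hφ] at h2
      ext1
      rw [h g g.2, h g' g'.2, ← ha, ← hφ, phase_unique hψ h1 h2]
    · rintro ⟨p, l, hl⟩
      refine ⟨⟨_, hl⟩, Subtype.ext ?_⟩
      obtain ⟨-, h1, h2⟩ := pauliUnit_injective (h _ hl)
      exact Prod.ext h1.symm h2.symm
  rw [hcard, finrank_labels, Module.natCard_eq_pow_finrank (K := ZMod 2), Nat.card_zmod]

/-! ### Quadratic phases on cosets -/

/-- `ψ` is supported on a single coset of `A`, and its translate by each element of `A` differs
from it by a phase `k + 2 φ` with `φ` linear: on the coset, `ψ` is the exponential of a `ℤ/4`-valued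
quadratic function. -/
structure IsQuadraticOn (A : Submodule (ZMod 2) G) (ψ : G → ℂ) : Prop where
  add_mem : ∀ x y, ψ x ≠ 0 → ψ y ≠ 0 → x + y ∈ A
  exists_fixed : ∀ a ∈ A, ∃ k φ, pauliOp k a φ *ᵥ ψ = ψ

/-- The diagonal operators in `S` annihilate the translations in `S`, and by the dimension count
they exhaust the annihilator, so they confine `ψ` to a coset of the translations. -/
theorem isQuadraticOn_of_card {S : Subgroup (Matrix G G ℂ)ˣ} {ψ : G → ℂ} (hψ : ψ ≠ 0)
    (hS : ∀ g ∈ S, ∃ k a φ, g = pauliUnit k a φ) (hfix : ∀ g ∈ S, (g : Matrix G G ℂ) *ᵥ ψ = ψ)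
    (hcard : Nat.card S = 2 ^ Module.finrank (ZMod 2) G) : IsQuadraticOn (shiftLabels S) ψ := by
  -- A diagonal operator takes the value `1` on the support of `ψ`.
  have hdiag : ∀ φ ∈ diagLabels S, ∀ x y, ψ x ≠ 0 → ψ y ≠ 0 → φ (x + y) = 0 := by
    intro φ hφ x y hx hy
    obtain ⟨k, hk⟩ := mem_diagLabels.mp hφ
    have h := pauliOp_mulVec_eq_self_iff.mp (hfix _ hk)
    have hone : ∀ z, ψ z ≠ 0 → k + double (φ z) = 0 := fun z hz =>
      iPow_eq_one (mul_right_cancel₀ hz (by rw [← h z, one_mul]; exact congrArg ψ (add_zero z)))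
    refine double_eq_zero ?_
    rw [map_add, map_add, add_left_cancel ((hone x hx).trans (hone y hy).symm), double_add_self]
  have hle : diagLabels S ≤ (shiftLabels S).dualAnnihilator := by
    intro φ hφ
    rw [Submodule.mem_dualAnnihilator]
    intro a ha
    obtain ⟨l, χ, hl⟩ := mem_shiftLabels.mp ha
    obtain ⟨x, hx⟩ := Function.ne_iff.mp hψ
    have := hdiag φ hφ x (x + a) hx (ne_zero_of_pauliOp_mulVec (hfix _ hl) hx)
    rwa [← add_assoc, ZModModule.add_self, zero_add] at this
  have heq : diagLabels S = (shiftLabels S).dualAnnihilator := by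
    refine Submodule.eq_of_le_of_finrank_eq hle ?_
    have h1 := Nat.pow_right_injective le_rfl ((card_eq_two_pow hψ hS hfix).symm.trans hcard)
    have h2 := Subspace.finrank_add_finrank_dualAnnihilator_eq (shiftLabels S)
    omega
  refine ⟨fun x y hx hy => ?_, fun a ha => ?_⟩
  · rw [← Subspace.forall_mem_dualAnnihilator_apply_eq_zero_iff, ← heq]
    exact fun φ hφ => hdiag φ hφ x y hx hy
  · obtain ⟨k, φ, h⟩ := mem_shiftLabels.mp ha
    exact ⟨k, φ, hfix _ h⟩

/-- The group of all Pauli operators fixing a vector with a quadratic phase on a coset has the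
maximal order. -/
theorem IsQuadraticOn.card_eq {A : Submodule (ZMod 2) G} {ψ : G → ℂ} (hA : IsQuadraticOn A ψ)
    (hψ : ψ ≠ 0) {S : Subgroup (Matrix G G ℂ)ˣ} (hS : ∀ g ∈ S, ∃ k a φ, g = pauliUnit k a φ)
    (hmem : ∀ k a φ, pauliUnit k a φ ∈ S ↔ pauliOp k a φ *ᵥ ψ = ψ) :
    Nat.card S = 2 ^ Module.finrank (ZMod 2) G := by
  have hfix : ∀ g ∈ S, (g : Matrix G G ℂ) *ᵥ ψ = ψ := by
    intro g hg
    obtain ⟨k, a, φ, rfl⟩ := hS g hg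
    exact (hmem k a φ).mp hg
  obtain ⟨x₀, hx₀⟩ := Function.ne_iff.mp hψ
  have hshift : shiftLabels S = A := by
    ext a
    simp only [mem_shiftLabels, hmem]
    refine ⟨?_, hA.exists_fixed a⟩
    rintro ⟨k, φ, h⟩
    have := hA.add_mem x₀ (x₀ + a) hx₀ (ne_zero_of_pauliOp_mulVec h hx₀)
    rwa [← add_assoc, ZModModule.add_self, zero_add] at this
  have hdiag : diagLabels S = A.dualAnnihilator := by
    ext φ
    simp only [mem_diagLabels, hmem, Submodule.mem_dualAnnihilator, pauliOp_mulVec_eq_self_iff,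
      add_zero]
    constructor
    · rintro ⟨k, h⟩ a ha
      obtain ⟨l, χ, hl⟩ := hA.exists_fixed a ha
      have hone : ∀ z, ψ z ≠ 0 → k + double (φ z) = 0 := fun z hz =>
        iPow_eq_one (mul_right_cancel₀ hz (by rw [← h z, one_mul]))
      refine double_eq_zero ?_
      have h1 := hone _ (ne_zero_of_pauliOp_mulVec hl hx₀)
      rwa [map_add, map_add, ← add_assoc, hone x₀ hx₀, zero_add] at h1
    · intro h
      refine ⟨double (φ x₀), fun x => ?_⟩
      by_cases hx : ψ x = 0
      · rw [hx, mul_zero]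
      · rw [← map_add double, ← map_add φ, h _ (hA.add_mem x₀ x hx₀ hx), map_zero,
          AddChar.map_zero_eq_one, one_mul]
  rw [card_eq_two_pow hψ hS hfix, hshift, hdiag, Subspace.finrank_add_finrank_dualAnnihilator_eq]

end Pauli

/-! ### The Pauli group -/

theorem eq_zero_or_eq_id (φ : Module.Dual (ZMod 2) (ZMod 2)) : φ = 0 ∨ φ = LinearMap.id := by
  exact (eq_zero_or_eq_one (φ 1)).imp (fun h => LinearMap.ext_ring h) (fun h => LinearMap.ext_ring h)

theorem unitX_eq : unitX = pauliUnit 0 1 0 := by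
  ext x y
  change matX x y = pauliOp 0 1 0 x y
  simp only [matX, Matrix.of_apply, pauliOp_apply, LinearMap.zero_apply, map_zero, add_zero,
    AddChar.map_zero_eq_one]
  rw [← ite_not]
  exact if_congr (by revert x y; decide) rfl rfl

theorem unitZ_eq : unitZ = pauliUnit 0 0 LinearMap.id := by
  ext x y
  change matZ x y = pauliOp 0 0 LinearMap.id x y
  simp only [matZ, Matrix.diagonal_apply, pauliOp_apply, LinearMap.id_apply, add_zero, zero_add,
    eq_comm (a := y)]
  refine if_ctx_congr Iff.rfl (fun h => ?_) (fun _ => rfl)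
  subst h
  have h2 : iPow 2 = -1 := by
    rw [iPow_apply, show (2 : ZMod 4).val = 2 from rfl, Complex.I_sq]
  obtain rfl | rfl := eq_zero_or_eq_one x
  · simp
  · exact h2.symm

theorem unitI_eq : unitI = pauliUnit 1 0 0 := by
  ext x y
  change (Complex.I • (1 : Op1)) x y = pauliOp 1 0 0 x y
  have h1 : iPow 1 = Complex.I := by
    rw [iPow_apply, show (1 : ZMod 4).val = 1 from rfl, pow_one]
  simp [pauliOp_apply, Matrix.one_apply, h1, eq_comm]

theorem mem_pauliGroup1_iff {u : Op1ˣ} : u ∈ pauliGroup1 ↔ ∃ k a φ, u = pauliUnit k a φ := by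
  constructor
  · intro h
    induction h using Subgroup.closure_induction with
    | mem x hx =>
      rcases hx with rfl | rfl | rfl
      · exact ⟨_, _, _, unitX_eq⟩
      · exact ⟨_, _, _, unitZ_eq⟩
      · exact ⟨_, _, _, unitI_eq⟩
    | one => exact ⟨0, 0, 0, pauliUnit_zero.symm⟩
    | mul x y _ _ hx hy =>
      obtain ⟨k, a, φ, rfl⟩ := hx
      obtain ⟨l, b, χ, rfl⟩ := hy
      exact ⟨_, _, _, pauliUnit_mul k l a b φ χ⟩
    | inv x _ hx =>
      obtain ⟨k, a, φ, rfl⟩ := hx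
      exact ⟨_, _, _, pauliUnit_inv k a φ⟩
  · rintro ⟨k, a, φ, rfl⟩
    have hI : pauliUnit k (0 : ZMod 2) 0 ∈ pauliGroup1 := by
      have hpow : ∀ m : ℕ, pauliUnit (m : ZMod 4) (0 : ZMod 2) 0 ∈ pauliGroup1 := by
        intro m
        induction m with
        | zero =>
          rw [Nat.cast_zero, pauliUnit_zero]
          exact one_mem _
        | succ m ih =>
          have := mul_mem ih (Subgroup.subset_closure (by simp) : unitI ∈ pauliGroup1)
          simpa [unitI_eq, pauliUnit_mul] using this
      simpa using hpow k.val
    have hX : pauliUnit 0 a 0 ∈ pauliGroup1 := by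
      fin_cases a
      · exact pauliUnit_zero (G := ZMod 2) ▸ one_mem _
      · exact unitX_eq ▸ Subgroup.subset_closure (by simp)
    have hZ : pauliUnit 0 0 φ ∈ pauliGroup1 := by
      rcases eq_zero_or_eq_id φ with rfl | rfl
      · exact pauliUnit_zero (G := ZMod 2) ▸ one_mem _
      · exact unitZ_eq ▸ Subgroup.subset_closure (by simp)
    simpa [pauliUnit_mul] using mul_mem (mul_mem hI hX) hZ

theorem tensorHom_pauliUnit {n : ℕ} (k : Fin n → ZMod 4) (a : Bits n)
    (φ : Fin n → Module.Dual (ZMod 2) (ZMod 2)) :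
    tensorHom n (fun v => pauliUnit (k v) (a v) (φ v)) =
      pauliUnit (∑ v, k v) a (∑ v, φ v ∘ₗ LinearMap.proj v) := by
  ext x y
  change ∏ v, pauliOp (k v) (a v) (φ v) (x v) (y v) = pauliOp _ _ _ x y
  simp only [pauliOp_apply]
  split_ifs with h
  · subst h
    simp only [Pi.add_apply, if_true, LinearMap.sum_apply, LinearMap.comp_apply,
      LinearMap.proj_apply, map_sum, ← Finset.sum_add_distrib]
    exact (map_prod iPow.toMonoidHom (fun v => .ofAdd (k v + double (φ v (x v + a v))))
      Finset.univ).symm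
  · obtain ⟨v, hv⟩ := Function.ne_iff.mp h
    exact Finset.prod_eq_zero (Finset.mem_univ v) (if_neg hv)

theorem exists_pauliUnit_of_mem_pauliGroup {n : ℕ} {g : (Op n)ˣ} (hg : g ∈ pauliGroup n) :
    ∃ k a φ, g = pauliUnit k a φ := by
  obtain ⟨u, hu, rfl⟩ := hg
  have hu' : ∀ v, ∃ k a φ, u v = pauliUnit k a φ := fun v =>
    mem_pauliGroup1_iff.mp (hu v (Set.mem_univ v))
  choose k a φ h using hu'
  exact ⟨_, _, _, by rw [funext h, tensorHom_pauliUnit]⟩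

theorem exists_dual_eq_sum {n : ℕ} (φ : Module.Dual (ZMod 2) (Bits n)) :
    φ = ∑ v, (φ ∘ₗ LinearMap.single (ZMod 2) (fun _ => ZMod 2) v) ∘ₗ LinearMap.proj v := by
  refine LinearMap.ext fun x => ?_
  simp only [LinearMap.sum_apply, LinearMap.comp_apply, LinearMap.proj_apply,
    LinearMap.single_apply]
  rw [← map_sum, Finset.univ_sum_single]

/-- For `n = 0` the Pauli group is trivial, without the scalar `i`; this is why `k = 0` has to be
assumed in that case. -/
theorem pauliUnit_mem_pauliGroup {n : ℕ} {k : ZMod 4} (hk : n = 0 → k = 0) (a : Bits n)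
    (φ : Module.Dual (ZMod 2) (Bits n)) : pauliUnit k a φ ∈ pauliGroup n := by
  obtain ⟨c, hc⟩ : ∃ c : Fin n → ZMod 4, ∑ v, c v = k := by
    cases n with
    | zero => exact ⟨0, by simp [hk rfl]⟩
    | succ n => exact ⟨Pi.single 0 k, by simp⟩
  rw [exists_dual_eq_sum φ, ← hc, ← tensorHom_pauliUnit]
  exact Subgroup.mem_map_of_mem _ fun v _ => mem_pauliGroup1_iff.mpr ⟨_, _, _, rfl⟩

/-! ### Stabilizer states have quadratic phases -/

theorem isStabilizerState_iff {n : ℕ} {ψ : StateVec n} :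
    IsStabilizerState ψ ↔ ψ ≠ 0 ∧ ∃ A, IsQuadraticOn A ψ := by
  refine and_congr_right fun hψ => ⟨?_, ?_⟩
  · rintro ⟨S, hS, hfix⟩
    exact ⟨_, isQuadraticOn_of_card hψ
      (fun g hg => exists_pauliUnit_of_mem_pauliGroup (hS.le_pauliGroup hg)) hfix
      (by simpa using hS.card_eq)⟩
  · rintro ⟨A, hA⟩
    let F : Subgroup (Op n)ˣ :=
      { carrier := {g | (g : Op n) *ᵥ ψ = ψ}
        one_mem' := by simp
        mul_mem' := by
          intro g h (hg : (g : Op n) *ᵥ ψ = ψ) (hh : (h : Op n) *ᵥ ψ = ψ)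
          change ((g * h : (Op n)ˣ) : Op n) *ᵥ ψ = ψ
          rw [Units.val_mul, ← Matrix.mulVec_mulVec, hh, hg]
        inv_mem' := by
          intro g (hg : (g : Op n) *ᵥ ψ = ψ)
          change ((g⁻¹ : (Op n)ˣ) : Op n) *ᵥ ψ = ψ
          conv_lhs => rw [← hg, Matrix.mulVec_mulVec, Units.inv_mul, Matrix.one_mulVec] }
    have hfix : ∀ g ∈ pauliGroup n ⊓ F, (g : Op n) *ᵥ ψ = ψ := fun g hg => hg.2
    have hpauli : ∀ g ∈ pauliGroup n ⊓ F, ∃ k a φ, g = pauliUnit k a φ := fun g hg =>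
      exists_pauliUnit_of_mem_pauliGroup hg.1
    refine ⟨pauliGroup n ⊓ F, ⟨inf_le_left, ?_, ?_, ?_⟩, hfix⟩
    · -- Two orders of a product have the same label, and `ψ` determines the phase.
      intro g hg h hh
      have h1 := hfix _ (mul_mem hg hh)
      have h2 := hfix _ (mul_mem hh hg)
      obtain ⟨k, a, φ, rfl⟩ := hpauli g hg
      obtain ⟨l, b, χ, rfl⟩ := hpauli h hh
      rw [pauliUnit_mul] at h1 h2 ⊢
      rw [pauliUnit_mul]
      rw [add_comm b a, add_comm χ φ] at h2 ⊢
      rw [phase_unique hψ h1 h2]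
    · intro h
      refine hψ (self_eq_neg.mp ?_)
      have := hfix _ h
      rwa [Units.val_neg, Units.val_one, Matrix.neg_mulVec, Matrix.one_mulVec, eq_comm] at this
    · rw [hA.card_eq hψ hpauli fun k a φ => ?_]
      · simp
      · refine ⟨fun h => h.2, fun h => ⟨pauliUnit_mem_pauliGroup ?_ a φ, h⟩⟩
        rintro rfl
        have h0 : pauliOp 0 a φ *ᵥ ψ = ψ := by
          rw [Subsingleton.elim a 0, Subsingleton.elim φ 0, pauliOp_zero, Matrix.one_mulVec]
        exact phase_unique hψ h h0

/-! ### Generalised two-graph states have quadratic phases -/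

section

variable {n : ℕ}

theorem GraphSet.magAdj_of_notMem (D : GraphSet n) {i : Fin n} (hi : i ∉ D.R) (j : Fin n) :
    D.magAdj i j = D.adj i j := by
  simp [GraphSet.magAdj, GraphSet.phaseAdj, hi]

theorem GraphSet.phaseAdj_of_mem (D : GraphSet n) {i j : Fin n} (hi : i ∈ D.R) (hj : j ∈ D.R) :
    D.phaseAdj i j = D.adj i j := by
  simp [GraphSet.phaseAdj, hi, hj]

theorem GraphSet.mag_eq_one_iff (D : GraphSet n) (x : Bits n) :
    D.mag x = 1 ↔ ∀ i ∉ D.R, x i = D.adj i i + ∑ j ∈ D.R, D.adj i j * x j := by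
  have hprod : ∀ (s : Finset (Fin n)) (f : Fin n → ZMod 2), ∏ i ∈ s, f i = 1 ↔ ∀ i ∈ s, f i = 1 := by
    intro s f
    refine ⟨fun h i hi => ?_, Finset.prod_eq_one⟩
    refine (eq_zero_or_eq_one (f i)).resolve_left fun h0 => ?_
    rw [Finset.prod_eq_zero hi h0] at h
    exact zero_ne_one h
  have hfactor : ∀ a b c : ZMod 2, a + 1 + b + c = 1 ↔ b = a + c := by
    decide
  rw [GraphSet.mag, hprod]
  refine forall_congr' fun i => ?_
  rw [Finset.mem_compl]
  refine forall_congr' fun hi => ?_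
  simp only [D.magAdj_of_notMem hi, hfactor]

/-- The directions of the support of a two-graph state: the solutions of the homogeneous system
belonging to the magnitude function. -/
def GraphSet.directions (D : GraphSet n) : Submodule (ZMod 2) (Bits n) where
  carrier := {a | ∀ i ∉ D.R, a i = ∑ j ∈ D.R, D.adj i j * a j}
  zero_mem' := by simp
  add_mem' := by
    intro a b ha hb i hi
    simp only [Pi.add_apply, mul_add, Finset.sum_add_distrib, ha i hi, hb i hi]
  smul_mem' := by
    intro c a ha i hi
    simp only [Pi.smul_apply, smul_eq_mul, ha i hi, Finset.mul_sum, mul_left_comm]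

theorem GraphSet.mag_add (D : GraphSet n) {a : Bits n} (ha : a ∈ D.directions) (x : Bits n) :
    D.mag (x + a) = D.mag x := by
  have h : D.mag (x + a) = 1 ↔ D.mag x = 1 := by
    simp only [GraphSet.mag_eq_one_iff, Pi.add_apply, mul_add, Finset.sum_add_distrib]
    refine forall₂_congr fun i hi => ?_
    rw [ha i hi, ← add_assoc, add_left_inj]
  generalize D.mag (x + a) = u, D.mag x = v at h
  revert u v
  decide

theorem GraphSet.add_mem_directions (D : GraphSet n) {x y : Bits n} (hx : D.mag x = 1)
    (hy : D.mag y = 1) : x + y ∈ D.directions := by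
  rw [GraphSet.mag_eq_one_iff] at hx hy
  intro i hi
  simp only [Pi.add_apply, mul_add, Finset.sum_add_distrib]
  rw [hx i hi, hy i hi, add_add_add_comm, ZModModule.add_self, zero_add]

/-- The polar form of the generalised quadratic phase function. The vertices of `Q` contribute to
it because `(x + a) - x - a = -2 x a` when the bits are read in `ℤ/4`. -/
def GenGraphSet.polar (D : GenGraphSet n) (a : Bits n) : Module.Dual (ZMod 2) (Bits n) :=
  (∑ i ∈ D.R, ∑ j ∈ D.R with i < j,
      D.phaseAdj i j • (a j • LinearMap.proj i + a i • LinearMap.proj j)) +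
    ∑ j ∈ D.R, if j ∈ D.Q then a j • LinearMap.proj j else 0

theorem GenGraphSet.genPhase_add (D : GenGraphSet n) (x a : Bits n) :
    D.genPhase (x + a) = D.genPhase x + D.genPhase a + double (D.polar a x) := by
  have hedge : ∀ p xi xj ai aj : ZMod 2, 2 * lift4 p * lift4 (xi + ai) * lift4 (xj + aj) =
      2 * lift4 p * lift4 xi * lift4 xj + 2 * lift4 p * lift4 ai * lift4 aj +
        double (p * (aj * xi + ai * xj)) := by
    decide
  have hvertex₀ : ∀ p xj aj : ZMod 2, (2 * lift4 p + 0) * lift4 (xj + aj) =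
      (2 * lift4 p + 0) * lift4 xj + (2 * lift4 p + 0) * lift4 aj := by
    decide
  have hvertex₁ : ∀ p xj aj : ZMod 2, (2 * lift4 p + 1) * lift4 (xj + aj) =
      (2 * lift4 p + 1) * lift4 xj + (2 * lift4 p + 1) * lift4 aj + double (aj * xj) := by
    decide
  have hvertex : ∀ j, (2 * lift4 (D.phaseAdj j j) + if j ∈ D.Q then 1 else 0) * lift4 (x j + a j) =
      (2 * lift4 (D.phaseAdj j j) + if j ∈ D.Q then 1 else 0) * lift4 (x j) +
        (2 * lift4 (D.phaseAdj j j) + if j ∈ D.Q then 1 else 0) * lift4 (a j) +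
        double ((if j ∈ D.Q then a j • LinearMap.proj j else 0 : Module.Dual (ZMod 2) (Bits n)) x) := by
    intro j
    split_ifs
    · exact hvertex₁ _ _ _
    · simpa using hvertex₀ (D.phaseAdj j j) (x j) (a j)
  simp only [GenGraphSet.genPhase, GenGraphSet.polar, Pi.add_apply, hedge, hvertex,
    Finset.sum_add_distrib, LinearMap.add_apply, LinearMap.sum_apply, LinearMap.smul_apply,
    LinearMap.proj_apply, smul_eq_mul, map_add, map_sum, mul_add]
  abel

theorem IsGenTwoGraphState.isQuadraticOn {ψ : StateVec n} (h : IsGenTwoGraphState ψ) :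
    ∃ A, IsQuadraticOn A ψ := by
  obtain ⟨D, c, hc, hψ⟩ := h
  have hmag : ∀ x, ψ x ≠ 0 → D.mag x = 1 := by
    intro x hx
    refine (eq_zero_or_eq_one _).resolve_left fun h0 => hx ?_
    rw [hψ, h0]
    simp
  refine ⟨D.directions, fun x y hx hy => D.add_mem_directions (hmag x hx) (hmag y hy),
    fun a ha => ⟨D.genPhase a, D.polar a, pauliOp_mulVec_eq_self_iff.mpr fun x => ?_⟩⟩
  rw [hψ, hψ, D.mag_add ha, ← iPow_apply, ← iPow_apply, D.genPhase_add, add_assoc,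
    AddChar.map_add_eq_mul]
  ring

/-- The support is nonempty: it contains the vector which vanishes on `R` and whose other
coordinates are the loops of the graph. -/
theorem IsGenTwoGraphState.ne_zero {ψ : StateVec n} (h : IsGenTwoGraphState ψ) : ψ ≠ 0 := by
  obtain ⟨D, c, hc, hψ⟩ := h
  let x : Bits n := fun i => if i ∈ D.R then 0 else D.adj i i
  have hx : D.mag x = 1 := by
    rw [GraphSet.mag_eq_one_iff]
    intro i hi
    rw [Finset.sum_eq_zero fun j hj => by simp [x, hj], add_zero]
    exact if_neg hi
  refine Function.ne_iff.mpr ⟨x, ?_⟩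
  rw [hψ, hx, ← iPow_apply]
  exact mul_ne_zero (mul_ne_zero hc (by simp [ZMod.val_one])) (iPow_ne_zero _)

/-! ### Quadratic phases come from graphs -/

/-- A subspace of `(ℤ/2)ⁿ` is the graph of a linear map on some set `R` of coordinates: it has
vectors restricting to the standard basis on `R`, and its elements are determined on `R`. -/
theorem exists_information_set (A : Submodule (ZMod 2) (Bits n)) :
    ∃ (R : Finset (Fin n)) (e : Fin n → Bits n),
      (∀ j ∈ R, e j ∈ A ∧ ∀ i ∈ R, e j i = if i = j then 1 else 0) ∧
      ∀ a ∈ A, a = ∑ j ∈ R, a j • e j := by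
  classical
  -- Minimality of `R` provides, for each `j ∈ R`, a nonzero vector vanishing on `R \ {j}`.
  obtain ⟨R, hR, hmin⟩ := Finset.exists_min_image
    (Finset.univ.filter fun R : Finset (Fin n) => ∀ a ∈ A, (∀ i ∈ R, a i = 0) → a = 0) Finset.card
    ⟨Finset.univ, Finset.mem_filter.mpr
      ⟨Finset.mem_univ _, fun a _ h => funext fun i => h i (Finset.mem_univ i)⟩⟩
  simp only [Finset.mem_filter, Finset.mem_univ, true_and] at hR hmin
  have hbasis : ∀ j, ∃ e : Bits n, j ∈ R → e ∈ A ∧ ∀ i ∈ R, e i = if i = j then 1 else 0 := by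
    intro j
    by_cases hj : j ∈ R
    · have hnot : ¬ ∀ a ∈ A, (∀ i ∈ R.erase j, a i = 0) → a = 0 := fun h =>
        (Finset.card_erase_lt_of_mem hj).not_ge (hmin _ h)
      push Not at hnot
      obtain ⟨e, he, hzero, hne⟩ := hnot
      refine ⟨e, fun _ => ⟨he, fun i hi => ?_⟩⟩
      split_ifs with hij
      · subst hij
        refine (eq_zero_or_eq_one _).resolve_left fun h0 => hne (hR e he fun k hk => ?_)
        by_cases hki : k = i
        · rw [hki, h0]
        · exact hzero k (Finset.mem_erase.mpr ⟨hki, hk⟩)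
      · exact hzero i (Finset.mem_erase.mpr ⟨hij, hi⟩)
    · exact ⟨0, fun h => absurd h hj⟩
  choose e he using hbasis
  refine ⟨R, e, he, fun a ha => sub_eq_zero.mp (hR _ (A.sub_mem ha
    (A.sum_mem fun j hj => A.smul_mem _ (he j hj).1)) fun i hi => ?_)⟩
  rw [Pi.sub_apply, Finset.sum_apply, Finset.sum_congr rfl fun j hj => by
    rw [Pi.smul_apply, (he j hj).2 i hi]]
  simp [hi]

/-- Moving through the support along the vectors `e j` in increasing order of `j` multiplies `ψ`
by the exponential of a quadratic form in the coordinates. -/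
theorem apply_add_sum {ψ : StateVec n} {R : Finset (Fin n)} {e : Fin n → Bits n}
    {k : Fin n → ZMod 4} {φ : Fin n → Module.Dual (ZMod 2) (Bits n)}
    (hfix : ∀ j ∈ R, pauliOp (k j) (e j) (φ j) *ᵥ ψ = ψ) (x₀ y : Bits n) :
    ψ (x₀ + ∑ j ∈ R, y j • e j) =
      iPow ((∑ i ∈ R, ∑ j ∈ R with i < j, 2 * lift4 (φ j (e i)) * lift4 (y i) * lift4 (y j)) +
        ∑ j ∈ R, (k j + double (φ j x₀)) * lift4 (y j)) * ψ x₀ := by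
  have hstep : ∀ k a φ, pauliOp k a φ *ᵥ ψ = ψ → ∀ (z : ZMod 2) x,
      ψ (x + z • a) = iPow ((k + double (φ x)) * lift4 z) * ψ x := by
    intro k a φ h z x
    rcases eq_zero_or_eq_one z with rfl | rfl
    · rw [show lift4 0 = 0 from rfl]
      simp
    · rw [show lift4 1 = 1 from rfl, one_smul, mul_one]
      exact pauliOp_mulVec_eq_self_iff.mp h x
  have hmul : ∀ p z w : ZMod 2, double (z * p) * lift4 w = 2 * lift4 p * lift4 z * lift4 w := by
    decide
  induction R using Finset.induction_on_max with
  | empty => simp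
  | insert m T hlt ih =>
    have hm : m ∉ T := fun h => (hlt m h).false
    have hinner : ∀ i ∈ T, ∀ f : Fin n → ZMod 4,
        ∑ j ∈ insert m T with i < j, f j = f m + ∑ j ∈ T with i < j, f j := by
      intro i hi f
      rw [Finset.filter_insert, if_pos (hlt i hi), Finset.sum_insert (by simp [hm])]
    have houter : ∀ f : Fin n → ZMod 4, ∑ j ∈ insert m T with m < j, f j = 0 := by
      intro f
      refine Finset.sum_eq_zero fun j hj => ?_
      obtain ⟨hj, hmj⟩ := Finset.mem_filter.mp hj
      rcases Finset.mem_insert.mp hj with rfl | hj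
      · exact absurd hmj (lt_irrefl _)
      · exact absurd hmj (hlt j hj).asymm
    rw [Finset.sum_insert hm, add_comm (y m • e m), ← add_assoc,
      hstep _ _ _ (hfix m (Finset.mem_insert_self m T)),
      ih fun j hj => hfix j (Finset.mem_insert_of_mem hj), ← mul_assoc,
      ← AddChar.map_add_eq_mul, Finset.sum_insert hm, Finset.sum_insert hm, houter,
      Finset.sum_congr rfl fun i hi => hinner i hi _, Finset.sum_add_distrib]
    congr 2
    simp only [map_add, map_sum, map_smul, smul_eq_mul, add_mul, Finset.sum_mul, hmul]
    abel

theorem IsQuadraticOn.isGenTwoGraphState {A : Submodule (ZMod 2) (Bits n)} {ψ : StateVec n}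
    (hA : IsQuadraticOn A ψ) (hψ : ψ ≠ 0) : IsGenTwoGraphState ψ := by
  obtain ⟨R, e, he, hspan⟩ := exists_information_set A
  have hfix : ∀ j, ∃ k φ, j ∈ R → pauliOp k (e j) φ *ᵥ ψ = ψ := by
    intro j
    by_cases hj : j ∈ R
    · obtain ⟨k, φ, h⟩ := hA.exists_fixed (e j) (he j hj).1
      exact ⟨k, φ, fun _ => h⟩
    · exact ⟨0, 0, fun h => absurd h hj⟩
  choose k φ hfix using hfix
  -- The base point `x₀` of the support is normalised to vanish on `R`.
  obtain ⟨x₀, hx₀, hzero⟩ : ∃ x₀, ψ x₀ ≠ 0 ∧ ∀ i ∈ R, x₀ i = 0 := by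
    obtain ⟨x₁, hx₁⟩ := Function.ne_iff.mp hψ
    refine ⟨x₁ + ∑ j ∈ R, x₁ j • e j, ?_, fun i hi => ?_⟩
    · rw [apply_add_sum hfix]
      exact mul_ne_zero (iPow_ne_zero _) hx₁
    · rw [Pi.add_apply, Finset.sum_apply, Finset.sum_congr rfl fun j hj => by
        rw [Pi.smul_apply, (he j hj).2 i hi]]
      simp [hi, ZModModule.add_self]
  let t : Fin n → ZMod 4 := fun j => k j + double (φ j x₀)
  let D : GenGraphSet n :=
    { adj := Matrix.of fun i j =>
        if i = j then if i ∈ R then ((t i).val / 2 : ℕ) else x₀ i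
        else if i ∈ R then if j ∈ R then φ (max i j) (e (min i j)) else e i j
        else if j ∈ R then e j i else 0
      symm := by
        ext i j
        rcases eq_or_ne i j with rfl | hij
        · rfl
        · simp only [Matrix.transpose_apply, Matrix.of_apply, if_neg hij, if_neg hij.symm]
          rw [max_comm, min_comm]
          split_ifs <;> rfl
      R := R
      adj_left := fun i hi j hj hij => by simp [hi, hj, hij]
      Q := R.filter fun j => (t j).val % 2 = 1
      Q_subset := Finset.filter_subset _ _ }
  have hmag : ∀ x, D.mag x = 1 ↔ x = x₀ + ∑ j ∈ R, x j • e j := by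
    intro x
    rw [GraphSet.mag_eq_one_iff, funext_iff]
    have hin : ∀ i ∈ R, x i = (x₀ + ∑ j ∈ R, x j • e j) i := by
      intro i hi
      rw [Pi.add_apply, hzero i hi, zero_add, Finset.sum_apply, Finset.sum_congr rfl fun j hj => by
        rw [Pi.smul_apply, (he j hj).2 i hi]]
      simp [hi]
    have hout : ∀ i ∉ R, D.adj i i + ∑ j ∈ R, D.adj i j * x j =
        (x₀ + ∑ j ∈ R, x j • e j) i := by
      intro i hi
      rw [Pi.add_apply, Finset.sum_apply]
      congr 1
      · simp [D, hi]
      · refine Finset.sum_congr rfl fun j hj => ?_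
        have hij : i ≠ j := fun h => hi (h ▸ hj)
        simp [D, hi, hj, hij, mul_comm]
    constructor
    · intro h i
      by_cases hi : i ∈ R
      · exact hin i hi
      · exact (h i hi).trans (hout i hi)
    · exact fun h i hi => (h i).trans (hout i hi).symm
  have hphase : ∀ x, D.genPhase x =
      (∑ i ∈ R, ∑ j ∈ R with i < j, 2 * lift4 (φ j (e i)) * lift4 (x i) * lift4 (x j)) +
        ∑ j ∈ R, t j * lift4 (x j) := by
    intro x
    rw [GenGraphSet.genPhase]
    congr 1
    · refine Finset.sum_congr rfl fun i hi => Finset.sum_congr rfl fun j hj => ?_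
      obtain ⟨hj, hij⟩ := Finset.mem_filter.mp hj
      have hadj : D.phaseAdj i j = φ j (e i) := by
        rw [D.phaseAdj_of_mem hi hj]
        change (if i = j then _ else _) = _
        rw [if_neg hij.ne, if_pos (show i ∈ R from hi), if_pos (show j ∈ R from hj),
          max_eq_right hij.le, min_eq_left hij.le]
      rw [hadj]
    · refine Finset.sum_congr rfl fun j hj => ?_
      have hbits : ∀ s : ZMod 4,
          2 * lift4 ((s.val / 2 : ℕ) : ZMod 2) + (if s.val % 2 = 1 then 1 else 0) = s := by
        decide
      have hadj : D.phaseAdj j j = (((t j).val / 2 : ℕ) : ZMod 2) := by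
        rw [D.phaseAdj_of_mem hj hj]
        change (if j = j then _ else _) = _
        rw [if_pos rfl, if_pos (show j ∈ R from hj)]
      have hQ : j ∈ D.Q ↔ (t j).val % 2 = 1 := by
        simp [D, show j ∈ R from hj]
      rw [hadj, if_congr hQ rfl rfl, hbits]
  refine ⟨D, ψ x₀, hx₀, fun x => ?_⟩
  rw [← iPow_apply]
  rcases eq_zero_or_eq_one (D.mag x) with h | h
  · rw [h, ZMod.val_zero, Nat.cast_zero, mul_zero, zero_mul]
    by_contra hx
    -- Otherwise `x` lies in the coset `x₀ + A`, which the magnitude function selects.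
    have hdiff := hspan _ (hA.add_mem x₀ x hx₀ hx)
    have hmem : D.mag x = 1 := by
      rw [hmag]
      rw [Finset.sum_congr rfl fun j hj => by rw [Pi.add_apply, hzero j hj, zero_add]] at hdiff
      rw [← hdiff, ← add_assoc, ZModModule.add_self, zero_add]
    exact zero_ne_one (h.symm.trans hmem)
  · rw [h, hphase, ZMod.val_one, Nat.cast_one, mul_one, mul_comm]
    conv_lhs => rw [(hmag x).mp h]
    exact apply_add_sum hfix x₀ x

theorem IsTwoGraphState.isGenTwoGraphState {ψ : StateVec n} (h : IsTwoGraphState ψ) :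
    IsGenTwoGraphState ψ := by
  obtain ⟨D, c, hc, hψ⟩ := h
  refine ⟨⟨D, ∅, Finset.empty_subset _⟩, c, hc, fun x => ?_⟩
  have hphase : GenGraphSet.genPhase ⟨D, ∅, Finset.empty_subset _⟩ x = double (D.phase x) := by
    have hedge : ∀ p a b : ZMod 2, 2 * lift4 p * lift4 a * lift4 b = double (p * a * b) := by
      decide
    have hvertex : ∀ p a : ZMod 2, (2 * lift4 p + 0) * lift4 a = double (p * a) := by
      decide
    simp only [GenGraphSet.genPhase, GraphSet.phase, map_add, map_sum, hedge, hvertex,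
      Finset.notMem_empty, if_false]
  have hsign : ∀ z : ZMod 2, iPow (double z) = (-1) ^ z.val := by
    intro z
    rcases eq_zero_or_eq_one z with rfl | rfl
    · simp
    · rw [iPow_apply, show (double 1).val = 2 from rfl, Complex.I_sq, ZMod.val_one, pow_one]
  rw [hψ, ← hsign, ← hphase, iPow_apply]

end

end TwoGraphState

end

theorem corollary2 (n : ℕ) :
    (∀ ψ : TwoGraphState.StateVec n,
      TwoGraphState.IsGenTwoGraphState ψ ↔ TwoGraphState.IsStabilizerState ψ) ∧
    (∀ ψ : TwoGraphState.StateVec n, TwoGraphState.IsTwoGraphState ψ →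
      TwoGraphState.IsGenTwoGraphState ψ ∧ TwoGraphState.IsStabilizerState ψ) := by
  have key : ∀ ψ : TwoGraphState.StateVec n,
      TwoGraphState.IsGenTwoGraphState ψ ↔ TwoGraphState.IsStabilizerState ψ := by
    intro ψ
    rw [TwoGraphState.isStabilizerState_iff]
    exact ⟨fun h => ⟨h.ne_zero, h.isQuadraticOn⟩, fun ⟨hψ, A, hA⟩ => hA.isGenTwoGraphState hψ⟩
  exact ⟨key, fun ψ h => ⟨h.isGenTwoGraphState, (key ψ).mp h.isGenTwoGraphState⟩⟩
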